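/- \textbf{Setting.} A problem in the query model is a function $f : S \to H$ with $S \subseteq G^m$, where $G, H$ are finite alphabets; a query $i$ to the input $x \in S$ returns the character $x_i$. An \emph{adversary matrix} for $f$ is a symmetric, entrywise nonnegative real matrix $\Gamma$ indexed by $S \times S$ with $\Gamma[x,y] = 0$ whenever $f(x) = f(y)$. Let $D_i[x,y] = 1$ if $x_i \ne y_i$ and $D_i[x,y] = 0$ otherwise, let $\circ$ be the entrywise product and $\|\cdot\|$ the spectral norm. The optimal spectral adversary bound is $$SA(f) = \max_{\Gamma} \frac{\|\Gamma\|}{\max_i \|\Gamma \circ D_i\|},$$ where $\Gamma$ ranges over the nonzero adversary matrices ($SA(f) = 0$ if there are none). \textbf{Nested ordered search.} $OS_a$ is the problem with inputs $\uparrow^{k-1} * \downarrow^{a-k}$ ($1 \le k \le a$) and answer $k$. $HSOS_b$ is the problem with inputs $\rightarrow^{k-1} s \leftarrow^{b-k}$ ($1 \le k \le b$, $s \in \{\uparrow, \downarrow, *\}$) and answer $s$. $NOS_{a,b}$ is the composition $OS_a \circ (HSOS_b, \ldots, HSOS_b)$: its inputs are the concatenations $x^1 \cdots x^a$ of inputs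 of $HSOS_b$ whose string of answers $HSOS_b(x^1) \cdots HSOS_b(x^a)$ is an input of $OS_a$, and its answer is the answer of $OS_a$ on that string. \textbf{The Tarski problem.} $TARSKI(N,2)$ asks for a fixed point of a monotone function $f : [N]^2 \to [N]^2$ (coordinatewise order) which is queried at points of $[N]^2$. As a function problem it can be read in two ways: (a) the inputs are the monotone functions with exactly one fixed point, which is the answer; (b) the inputs are all monotone functions, and the answer is a fixed point selected by an arbitrary fixed rule. \textbf{Lemma.} For every integer $n \ge 2$, $$SA\bigl(TARSKI(n(n^2+n-1),\, 2)\bigr) \;\ge\; \frac17\, SA\bigl(NOS_{n+1,\,n}\bigr),$$ in reading (a), and in reading (b) for every selection rule. -/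

import Mathlib

/-! ### Problems in the query model -/

/-- A problem in the query model: the input is a string `x : ι → G` (positions `ι`, alphabet `G`)
from the domain, and the character `x i` is the response to the query `i`. -/
structure QueryProblem (ι G H : Type*) where
  /-- The set of admissible input strings. -/
  domain : Set (ι → G)
  /-- The answer to an admissible input. -/
  answer : domain → H

/-- The spectral norm of a real square matrix: its operator norm for the Euclidean norm. -/
noncomputable def spectralNorm₂ {α : Type*} [Finite α] (A : Matrix α α ℝ) : ℝ :=
  letI : Fintype α := Fintype.ofFinite α
  letI : DecidableEq α := Classical.decEq α
  ‖Matrix.toEuclideanCLM (𝕜 := ℝ) A‖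

namespace QueryProblem

/-- The distinguisher matrix of the query `i`, with entry `1` where the inputs differ at `i`. -/
noncomputable def distinguisher {ι G H : Type*} (P : QueryProblem ι G H) (i : ι) :
    Matrix P.domain P.domain ℝ :=
  open Classical in fun x y => if x.1 i = y.1 i then 0 else 1

/-- Adversary matrices: symmetric, entrywise nonnegative, and zero at every pair of inputs with
the same answer. -/
structure IsAdversary {ι G H : Type*} (P : QueryProblem ι G H)
    (Γ : Matrix P.domain P.domain ℝ) : Prop where
  symm : ∀ x y, Γ x y = Γ y x
  nonneg : ∀ x y, 0 ≤ Γ x y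
  zero_of_answer_eq : ∀ x y, P.answer x = P.answer y → Γ x y = 0

/-- The bound `‖Γ‖ / max_i ‖Γ ∘ D_i‖` given by a matrix `Γ`. The denominator is positive for every
nonzero adversary matrix; the zero matrix gets the value `0 / 0 = 0`. -/
noncomputable def adversaryRatio {ι G H : Type*} [Finite ι] [Finite G] (P : QueryProblem ι G H)
    (Γ : Matrix P.domain P.domain ℝ) : ℝ :=
  spectralNorm₂ Γ / ⨆ i : ι, spectralNorm₂ (Matrix.hadamard Γ (P.distinguisher i))

/-- The optimal spectral adversary bound. The set of values is nonempty and bounded above, see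
`zero_mem_adversaryRatios` and `bddAbove_adversaryRatios`. It is `0` for a problem all of whose
inputs have the same answer. -/
noncomputable def SA {ι G H : Type*} [Finite ι] [Finite G] (P : QueryProblem ι G H) : ℝ :=
  sSup {r : ℝ | ∃ Γ, P.IsAdversary Γ ∧ r = P.adversaryRatio Γ}

end QueryProblem

/-! The spectral adversary bound is a supremum of a nonempty bounded set. -/

theorem spectralNorm₂_nonneg {α : Type*} [Finite α] (A : Matrix α α ℝ) :
    0 ≤ spectralNorm₂ A := by
  let _ : Fintype α := Fintype.ofFinite α
  let _ : DecidableEq α := Classical.decEq α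
  exact norm_nonneg (Matrix.toEuclideanCLM (𝕜 := ℝ) A)

theorem spectralNorm₂_zero {α : Type*} [Finite α] :
    spectralNorm₂ (0 : Matrix α α ℝ) = 0 := by
  let _ : Fintype α := Fintype.ofFinite α
  let _ : DecidableEq α := Classical.decEq α
  change ‖Matrix.toEuclideanCLM (𝕜 := ℝ) (0 : Matrix α α ℝ)‖ = 0
  rw [map_zero, norm_zero]

theorem spectralNorm₂_sum_le {α κ : Type*} [Finite α] (s : Finset κ) (A : κ → Matrix α α ℝ) :
    spectralNorm₂ (∑ i ∈ s, A i) ≤ ∑ i ∈ s, spectralNorm₂ (A i) := by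
  let _ : Fintype α := Fintype.ofFinite α
  let _ : DecidableEq α := Classical.decEq α
  change ‖Matrix.toEuclideanCLM (𝕜 := ℝ) (∑ i ∈ s, A i)‖ ≤
    ∑ i ∈ s, ‖Matrix.toEuclideanCLM (𝕜 := ℝ) (A i)‖
  rw [map_sum]
  exact norm_sum_le _ _

theorem spectralNorm₂_mono {α : Type*} [Finite α] {A B : Matrix α α ℝ}
    (h0 : ∀ x y, 0 ≤ A x y) (h : ∀ x y, A x y ≤ B x y) :
    spectralNorm₂ A ≤ spectralNorm₂ B := by
  let _ : Fintype α := Fintype.ofFinite α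
  let _ : DecidableEq α := Classical.decEq α
  change ‖Matrix.toEuclideanCLM (𝕜 := ℝ) A‖ ≤ ‖Matrix.toEuclideanCLM (𝕜 := ℝ) B‖
  refine ContinuousLinearMap.opNorm_le_bound _ (norm_nonneg _) fun v => ?_
  let w : EuclideanSpace ℝ α := WithLp.toLp 2 fun i => |v i|
  have hw : ‖w‖ = ‖v‖ := by simp [w, EuclideanSpace.norm_eq]
  have key : ‖Matrix.toEuclideanCLM (𝕜 := ℝ) A v‖ ≤ ‖Matrix.toEuclideanCLM (𝕜 := ℝ) B w‖ := by
    rw [EuclideanSpace.norm_eq, EuclideanSpace.norm_eq]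
    refine Real.sqrt_le_sqrt (Finset.sum_le_sum fun i _ => ?_)
    refine pow_le_pow_left₀ (norm_nonneg _) ?_ 2
    have hA : (Matrix.toEuclideanCLM (𝕜 := ℝ) A v) i = ∑ j, A i j * v j := rfl
    have hB : (Matrix.toEuclideanCLM (𝕜 := ℝ) B w) i = ∑ j, B i j * |v j| := rfl
    rw [hA, hB, Real.norm_eq_abs, Real.norm_eq_abs]
    refine (Finset.abs_sum_le_sum_abs _ _).trans (le_trans ?_ (le_abs_self _))
    refine Finset.sum_le_sum fun j _ => ?_
    rw [abs_mul, abs_of_nonneg (h0 i j)]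
    exact mul_le_mul_of_nonneg_right (h i j) (abs_nonneg _)
  exact key.trans ((ContinuousLinearMap.le_opNorm _ _).trans_eq (by rw [hw]))

namespace QueryProblem

theorem zero_mem_adversaryRatios {ι G H : Type*} [Finite ι] [Finite G]
    (P : QueryProblem ι G H) :
    (0 : ℝ) ∈ {r : ℝ | ∃ Γ, P.IsAdversary Γ ∧ r = P.adversaryRatio Γ} :=
  ⟨0, ⟨fun _ _ => rfl, fun _ _ => le_rfl, fun _ _ _ => rfl⟩, by
    simp [adversaryRatio, spectralNorm₂_zero]⟩

theorem bddAbove_adversaryRatios {ι G H : Type*} [Finite ι] [Finite G]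
    (P : QueryProblem ι G H) :
    BddAbove {r : ℝ | ∃ Γ, P.IsAdversary Γ ∧ r = P.adversaryRatio Γ} := by
  let _ : Fintype ι := Fintype.ofFinite ι
  refine ⟨Fintype.card ι, ?_⟩
  rintro r ⟨Γ, hΓ, rfl⟩
  have hD : ∀ i x y, 0 ≤ P.distinguisher i x y := fun i x y => by
    unfold distinguisher; split_ifs <;> norm_num
  have hle : spectralNorm₂ Γ ≤
      Fintype.card ι * ⨆ i : ι, spectralNorm₂ (Matrix.hadamard Γ (P.distinguisher i)) := by
    calc spectralNorm₂ Γ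
        ≤ spectralNorm₂ (∑ i : ι, Matrix.hadamard Γ (P.distinguisher i)) := by
          refine spectralNorm₂_mono hΓ.nonneg fun x y => ?_
          rw [Matrix.sum_apply]
          by_cases hxy : x = y
          · rw [hΓ.zero_of_answer_eq x y (by rw [hxy])]
            exact Finset.sum_nonneg fun i _ => by
              simpa [Matrix.hadamard_apply] using mul_nonneg (hΓ.nonneg x y) (hD i x y)
          · obtain ⟨i, hi⟩ : ∃ i, x.1 i ≠ y.1 i := by
              by_contra! hc
              exact hxy (Subtype.ext (funext hc))
            calc Γ x y = Matrix.hadamard Γ (P.distinguisher i) x y := by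
                  simp [Matrix.hadamard_apply, distinguisher, hi]
              _ ≤ _ := Finset.single_le_sum
                  (f := fun i => Matrix.hadamard Γ (P.distinguisher i) x y)
                  (fun i _ => mul_nonneg (hΓ.nonneg x y) (hD i x y)) (Finset.mem_univ i)
      _ ≤ ∑ i : ι, spectralNorm₂ (Matrix.hadamard Γ (P.distinguisher i)) :=
          spectralNorm₂_sum_le _ _
      _ ≤ ∑ _i : ι, ⨆ i : ι, spectralNorm₂ (Matrix.hadamard Γ (P.distinguisher i)) :=
          Finset.sum_le_sum fun i _ => le_ciSup
            (f := fun i => spectralNorm₂ (Matrix.hadamard Γ (P.distinguisher i)))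
            (Set.finite_range _).bddAbove i
      _ = _ := by simp
  exact div_le_of_le_mul₀ (Real.iSup_nonneg fun i => spectralNorm₂_nonneg _)
    (Nat.cast_nonneg _) hle

/-- The composition `f ∘ (g_1, …, g_k)`: an input is the concatenation of one input `x^i` of each
inner problem `g_i`, such that the string of inner answers is an input of `f`. -/
def comp {κ : Type*} {ι : κ → Type*} {Φ Λ Ψ : Type*} (f : QueryProblem κ Λ Ψ)
    (g : (i : κ) → QueryProblem (ι i) Φ Λ) : QueryProblem (Σ i, ι i) Φ Ψ where
  domain := {x | ∃ hx : ∀ i, (fun j => x ⟨i, j⟩) ∈ (g i).domain,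
    (fun i => (g i).answer ⟨fun j => x ⟨i, j⟩, hx i⟩) ∈ f.domain}
  answer x := f.answer ⟨fun i => (g i).answer ⟨fun j => x.1 ⟨i, j⟩, x.2.1 i⟩, x.2.2⟩

end QueryProblem

/-! ### Ordered search -/

/-- The alphabet `{↑, *, ↓}`. -/
inductive OSSymbol
  | up | star | down
  deriving DecidableEq

instance : Fintype OSSymbol := ⟨{.up, .star, .down}, by rintro ⟨⟩ <;> simp⟩

/-- The alphabet `{→, ←, ↑, *, ↓}`. -/
inductive HSSymbol
  | right | left | hidden (s : OSSymbol)
  deriving DecidableEq, Fintype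

/-- The string `↑ ⋯ ↑ * ↓ ⋯ ↓` of length `m` with `*` at position `k`. -/
def osString (m : ℕ) (k : Fin m) : Fin m → OSSymbol := fun j =>
  if j < k then .up else if j = k then .star else .down

/-- The string `→ ⋯ → s ← ⋯ ←` of length `m` with `s` at position `k`. -/
def hsosString (m : ℕ) (k : Fin m) (s : OSSymbol) : Fin m → HSSymbol := fun j =>
  if j < k then .right else if j = k then .hidden s else .left

/-- Ordered search on `m` elements: return the position of `*`. -/
noncomputable def orderedSearch (m : ℕ) : QueryProblem (Fin m) OSSymbol (Fin m) where
  domain := {x | ∃ k, x = osString m k}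
  answer x := x.2.choose

/-- Hidden-symbol ordered search on `m` elements: return the hidden symbol. -/
noncomputable def hiddenSymbolOrderedSearch (m : ℕ) :
    QueryProblem (Fin m) HSSymbol OSSymbol where
  domain := {x | ∃ s k, x = hsosString m k s}
  answer x := x.2.choose

/-! The answers of the two search problems do not depend on a choice. -/

theorem orderedSearch_answer (m : ℕ) (k : Fin m) :
    (orderedSearch m).answer ⟨osString m k, k, rfl⟩ = k := by
  have hx : ∃ k', osString m k = osString m k' := ⟨k, rfl⟩
  change hx.choose = k
  have h := congrFun hx.choose_spec k
  by_contra hne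
  rcases lt_or_gt_of_ne hne with hlt | hlt
  · simp [osString, not_lt.2 hlt.le, Ne.symm hne] at h
  · simp [osString, hlt] at h

theorem hiddenSymbolOrderedSearch_answer (m : ℕ) (k : Fin m) (s : OSSymbol) :
    (hiddenSymbolOrderedSearch m).answer ⟨hsosString m k s, s, k, rfl⟩ = s := by
  have hx : ∃ s' k', hsosString m k s = hsosString m k' s' := ⟨s, k, rfl⟩
  change hx.choose = s
  obtain ⟨k', hk'⟩ := hx.choose_spec
  have h := congrFun hk' k
  simp only [hsosString, lt_irrefl, if_false, if_true] at h
  split_ifs at h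
  exact (HSSymbol.hidden.inj h).symm

/-- Nested ordered search: ordered search on `a` elements composed with `a` copies of
hidden-symbol ordered search on `b` elements. -/
noncomputable def nestedOrderedSearch (a b : ℕ) :
    QueryProblem (Σ _ : Fin a, Fin b) HSSymbol (Fin a) :=
  (orderedSearch a).comp fun _ => hiddenSymbolOrderedSearch b

/-! ### The Tarski problem -/

/-- The `k`-dimensional grid of side length `n`, with the coordinatewise order. -/
abbrev Grid (n k : ℕ) : Type := Fin k → Fin n

/-- The Tarski problem on the monotone self-maps of the grid with exactly one fixed point. -/
noncomputable def tarskiUnique (n k : ℕ) : QueryProblem (Grid n k) (Grid n k) (Grid n k) where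
  domain := {f | Monotone f ∧ ∃! v, f v = v}
  answer f := f.2.2.choose

/-- The Tarski problem on all monotone self-maps of the grid, for a rule `F` that says which
vertex counts as the answer. -/
def tarskiAll (n k : ℕ) (F : {f : Grid n k → Grid n k // Monotone f} → Grid n k) :
    QueryProblem (Grid n k) (Grid n k) (Grid n k) where
  domain := {f | Monotone f}
  answer := F

/-! Inputs of nested ordered search are embedded injectively into monotone functions with a unique
fixed point, so that different answers give different fixed points and every value of the function
is determined by at most three characters of the input. An adversary matrix then extends by zero.
Its norm does not drop, and each `Γ ∘ D_v` is dominated entrywise by a sum of three old matrices `Γ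
∘ D_i`, so the bound loses at most a factor 3, well within the stated 7
(`QueryProblem.SA_le_mul_of_embedding`).

The functions are herringbones. A monotone lattice path, the spine, joins two opposite corners of
the grid. Points off the spine move along their antidiagonal towards it, and points on it move along
it towards the fixed point.

The offset of the spine from the diagonal encodes the hidden positions `p 0, …, p n`. Stage `i`
moves the offset from `p i` to `p (i + 1)` and is split into `n` periods. The move takes place in
the period whose number is `p i`, and each period is long enough for any move. At a point with
offset `d` in period `j` of stage `i`, querying position `j` of block `i` tells whether the move is
still to come, under way or over. Position `d` of block `i` or of block `i + 1` then locates the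
spine relative to the point. On the spine itself one of these queries hits a hidden symbol, which
gives the direction to the fixed point; this is placed where the offset has settled at `p k` for the
answer `k` (`herringboneStep_determined`). -/

/-! ### Spectral norms and submatrices -/

theorem spectralNorm₂_eq {α : Type*} [i : Fintype α] [d : DecidableEq α] (A : Matrix α α ℝ) :
    spectralNorm₂ A = ‖Matrix.toEuclideanCLM (𝕜 := ℝ) A‖ := by
  unfold spectralNorm₂
  generalize Fintype.ofFinite α = i'
  obtain rfl : i' = i := Subsingleton.elim _ _
  generalize Classical.decEq α = d'
  obtain rfl : d' = d := Subsingleton.elim _ _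
  rfl

theorem spectralNorm₂_le_of_forall {α : Type*} [Fintype α] {A : Matrix α α ℝ} {c : ℝ}
    (hc : 0 ≤ c) (h : ∀ v : α → ℝ, ∑ i, (∑ j, A i j * v j) ^ 2 ≤ c ^ 2 * ∑ i, v i ^ 2) :
    spectralNorm₂ A ≤ c := by
  classical
  rw [spectralNorm₂_eq]
  refine ContinuousLinearMap.opNorm_le_bound _ hc fun v => ?_
  refine le_of_sq_le_sq ?_ (by positivity)
  rw [mul_pow, EuclideanSpace.real_norm_sq_eq, EuclideanSpace.real_norm_sq_eq]
  exact h v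

theorem sum_sq_le_spectralNorm₂ {α : Type*} [Fintype α] (A : Matrix α α ℝ) (v : α → ℝ) :
    ∑ i, (∑ j, A i j * v j) ^ 2 ≤ spectralNorm₂ A ^ 2 * ∑ i, v i ^ 2 := by
  classical
  rw [spectralNorm₂_eq]
  have h := pow_le_pow_left₀ (norm_nonneg _)
    ((Matrix.toEuclideanCLM (𝕜 := ℝ) A).le_opNorm (WithLp.toLp 2 v)) 2
  rw [mul_pow, EuclideanSpace.real_norm_sq_eq, EuclideanSpace.real_norm_sq_eq] at h
  exact h

/-- Passing to a submatrix does not increase the spectral norm. -/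
theorem spectralNorm₂_submatrix_le {α β : Type*} [Finite α] [Finite β] (B : Matrix β β ℝ)
    {e : α → β} (he : Function.Injective e) :
    spectralNorm₂ (B.submatrix e e) ≤ spectralNorm₂ B := by
  classical
  have := Fintype.ofFinite α
  have := Fintype.ofFinite β
  refine spectralNorm₂_le_of_forall (spectralNorm₂_nonneg _) fun v => ?_
  have hext : ∀ F : β → ℝ, (∀ b, b ∉ Set.range e → F b = 0) → ∑ x, F (e x) = ∑ b, F b :=
    fun F hF => Finset.sum_of_injOn e he.injOn (by simp) (fun b _ hb => hF b (by simpa using hb))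
      (fun _ _ => rfl)
  have hw : ∀ x, Function.extend e v 0 (e x) = v x := fun x => he.extend_apply v 0 x
  have hw0 : ∀ b, b ∉ Set.range e → Function.extend e v 0 b = 0 := fun b hb =>
    Function.extend_apply' _ _ _ hb
  calc ∑ x, (∑ y, B (e x) (e y) * v y) ^ 2
      = ∑ x, (∑ b, B (e x) b * Function.extend e v 0 b) ^ 2 := by
        refine Finset.sum_congr rfl fun x _ => ?_
        rw [← hext (fun b => B (e x) b * Function.extend e v 0 b)
          (fun b hb => by simp only [hw0 b hb, mul_zero])]
        simp only [hw]
    _ ≤ ∑ a, (∑ b, B a b * Function.extend e v 0 b) ^ 2 := by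
        rw [← Finset.sum_image (f := fun a => (∑ b, B a b * Function.extend e v 0 b) ^ 2)
          he.injOn]
        exact Finset.sum_le_sum_of_subset_of_nonneg (Finset.subset_univ _)
          fun _ _ _ => sq_nonneg _
    _ ≤ spectralNorm₂ B ^ 2 * ∑ b, Function.extend e v 0 b ^ 2 := sum_sq_le_spectralNorm₂ _ _
    _ = spectralNorm₂ B ^ 2 * ∑ x, v x ^ 2 := by
        rw [← hext (fun b => Function.extend e v 0 b ^ 2)
          (fun b hb => by simp only [hw0 b hb]; norm_num)]
        simp only [hw]

/-- A matrix that vanishes off a submatrix has at most the spectral norm of that submatrix. -/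
theorem spectralNorm₂_le_submatrix {α β : Type*} [Finite α] [Finite β] (B : Matrix β β ℝ)
    {e : α → β} (he : Function.Injective e)
    (hB : ∀ a b, a ∉ Set.range e ∨ b ∉ Set.range e → B a b = 0) :
    spectralNorm₂ B ≤ spectralNorm₂ (B.submatrix e e) := by
  classical
  have := Fintype.ofFinite α
  have := Fintype.ofFinite β
  refine spectralNorm₂_le_of_forall (spectralNorm₂_nonneg _) fun v => ?_
  have hext : ∀ F : β → ℝ, (∀ b, b ∉ Set.range e → F b = 0) → ∑ x, F (e x) = ∑ b, F b :=
    fun F hF => Finset.sum_of_injOn e he.injOn (by simp) (fun b _ hb => hF b (by simpa using hb))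
      (fun _ _ => rfl)
  calc ∑ a, (∑ b, B a b * v b) ^ 2
      = ∑ x, (∑ b, B (e x) b * v b) ^ 2 := by
        rw [← hext (fun a => (∑ b, B a b * v b) ^ 2)]
        intro a ha
        have : ∑ b, B a b * v b = 0 :=
          Finset.sum_eq_zero fun b _ => by rw [hB a b (Or.inl ha), zero_mul]
        rw [this]; norm_num
    _ = ∑ x, (∑ y, B.submatrix e e x y * v (e y)) ^ 2 := by
        refine Finset.sum_congr rfl fun x _ => ?_
        rw [← hext (fun b => B (e x) b * v b)
          (fun b hb => by rw [hB _ b (Or.inr hb), zero_mul])]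
        rfl
    _ ≤ spectralNorm₂ (B.submatrix e e) ^ 2 * ∑ x, v (e x) ^ 2 :=
        sum_sq_le_spectralNorm₂ _ fun x => v (e x)
    _ ≤ spectralNorm₂ (B.submatrix e e) ^ 2 * ∑ b, v b ^ 2 := by
        refine mul_le_mul_of_nonneg_left ?_ (sq_nonneg _)
        rw [← Finset.sum_image (f := fun b => v b ^ 2) he.injOn]
        exact Finset.sum_le_sum_of_subset_of_nonneg (Finset.subset_univ _)
          fun _ _ _ => sq_nonneg _

theorem spectralNorm₂_eq_zero {α : Type*} [Finite α] {A : Matrix α α ℝ} :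
    spectralNorm₂ A = 0 ↔ A = 0 := by
  classical
  have := Fintype.ofFinite α
  rw [spectralNorm₂_eq, norm_eq_zero]
  exact EmbeddingLike.map_eq_zero_iff

/-! ### Transfer of the adversary bound along an embedding of inputs -/

namespace QueryProblem

variable {ι κ G G' H H' : Type*}

theorem distinguisher_nonneg (P : QueryProblem ι G H) (i : ι) (x y : P.domain) :
    0 ≤ P.distinguisher i x y := by
  unfold distinguisher
  split_ifs <;> norm_num

/-- If the queries distinguish the inputs with a zero norm, then the matrix is zero. -/
theorem IsAdversary.eq_zero [Finite ι] [Finite G] {P : QueryProblem ι G H}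
    {Γ : Matrix P.domain P.domain ℝ} (hΓ : P.IsAdversary Γ)
    (h : ∀ i, spectralNorm₂ (Matrix.hadamard Γ (P.distinguisher i)) = 0) : Γ = 0 := by
  ext x y
  by_contra hne
  have hxy : x ≠ y := fun hxy => hne (hΓ.zero_of_answer_eq x y (by rw [hxy]))
  obtain ⟨i, hi⟩ : ∃ i, x.1 i ≠ y.1 i := by
    by_contra! hc
    exact hxy (Subtype.ext (funext hc))
  have := congrFun (congrFun (spectralNorm₂_eq_zero.1 (h i)) x) y
  simp [Matrix.hadamard_apply, distinguisher, hi] at this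
  exact hne this

/-- Inputs of `P` are embedded as inputs of `Q`, preserving the difference of answers, such that
every query of `Q` is answered by at most `c` queries of `P`. -/
theorem SA_le_mul_of_embedding [Finite ι] [Finite κ] [Finite G] [Finite G']
    (P : QueryProblem ι G H) (Q : QueryProblem κ G' H') (c : ℕ) (e : P.domain → Q.domain)
    (he : Function.Injective e)
    (hans : ∀ x y, P.answer x ≠ P.answer y → Q.answer (e x) ≠ Q.answer (e y))
    (hq : ∀ v, ∃ s : Finset ι, s.card ≤ c ∧
      ∀ x y : P.domain, (∀ i ∈ s, x.1 i = y.1 i) → (e x).1 v = (e y).1 v) :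
    P.SA ≤ c * Q.SA := by
  classical
  refine csSup_le ⟨0, P.zero_mem_adversaryRatios⟩ ?_
  rintro r ⟨Γ, hΓ, rfl⟩
  -- `Γ` is transported along `e` and extended by zero; injectivity makes the chosen preimages the
  -- right ones.
  let Δ : Matrix Q.domain Q.domain ℝ := fun a b =>
    if h : a ∈ Set.range e ∧ b ∈ Set.range e then Γ h.1.choose h.2.choose else 0
  have hΔ : ∀ x y, Δ (e x) (e y) = Γ x y := by
    intro x y
    have h : e x ∈ Set.range e ∧ e y ∈ Set.range e := ⟨⟨x, rfl⟩, ⟨y, rfl⟩⟩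
    change (if h : e x ∈ Set.range e ∧ e y ∈ Set.range e then Γ h.1.choose h.2.choose else 0) = _
    rw [dif_pos h, he h.1.choose_spec, he h.2.choose_spec]
  have hΔ0 : ∀ a b, a ∉ Set.range e ∨ b ∉ Set.range e → Δ a b = 0 := fun a b h =>
    dif_neg (by tauto)
  have hcases : ∀ {p : Q.domain → Q.domain → Prop}, (∀ x y, p (e x) (e y)) →
      (∀ a b, a ∉ Set.range e ∨ b ∉ Set.range e → p a b) → ∀ a b, p a b := by
    intro p h1 h2 a b
    by_cases ha : a ∈ Set.range e
    · by_cases hb : b ∈ Set.range e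
      · obtain ⟨x, rfl⟩ := ha
        obtain ⟨y, rfl⟩ := hb
        exact h1 x y
      · exact h2 a b (Or.inr hb)
    · exact h2 a b (Or.inl ha)
  have hadv : Q.IsAdversary Δ := by
    refine ⟨hcases (fun x y => ?_) fun a b h => ?_, hcases (fun x y => ?_) fun a b h => ?_,
      hcases (fun x y h => ?_) fun a b h _ => hΔ0 a b h⟩
    · rw [hΔ, hΔ, hΓ.symm]
    · rw [hΔ0 a b h, hΔ0 b a h.symm]
    · rw [hΔ]; exact hΓ.nonneg x y
    · rw [hΔ0 a b h]
    · rw [hΔ]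
      exact hΓ.zero_of_answer_eq x y (by_contra fun hne => hans x y hne h)
  have hsub : Δ.submatrix e e = Γ := by
    ext x y
    exact hΔ x y
  have hnorm : spectralNorm₂ Γ ≤ spectralNorm₂ Δ := by
    conv_lhs => rw [← hsub]
    exact spectralNorm₂_submatrix_le Δ he
  set M := ⨆ i, spectralNorm₂ (Matrix.hadamard Γ (P.distinguisher i)) with hM
  set M' := ⨆ v, spectralNorm₂ (Matrix.hadamard Δ (Q.distinguisher v)) with hM'
  have hMle : ∀ i, spectralNorm₂ (Matrix.hadamard Γ (P.distinguisher i)) ≤ M := fun i =>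
    le_ciSup (f := fun i => spectralNorm₂ (Matrix.hadamard Γ (P.distinguisher i)))
      (Set.finite_range _).bddAbove i
  have hM'le : ∀ v, spectralNorm₂ (Matrix.hadamard Δ (Q.distinguisher v)) ≤ M' := fun v =>
    le_ciSup (f := fun v => spectralNorm₂ (Matrix.hadamard Δ (Q.distinguisher v)))
      (Set.finite_range _).bddAbove v
  have hM0 : 0 ≤ M := Real.iSup_nonneg fun i => spectralNorm₂_nonneg _
  have hM'0 : 0 ≤ M' := Real.iSup_nonneg fun i => spectralNorm₂_nonneg _
  -- If `e x` and `e y` differ at `v`, then `x` and `y` differ at some query in `s`. For nonnegative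
  -- matrices this entrywise domination passes to the norms.
  have hkey : M' ≤ c * M := by
    refine Real.iSup_le (fun v => ?_) (by positivity)
    obtain ⟨s, hs, hdet⟩ := hq v
    have h0 : ∀ i x y, 0 ≤ Matrix.hadamard Γ (P.distinguisher i) x y := fun i x y =>
      mul_nonneg (hΓ.nonneg x y) (P.distinguisher_nonneg i x y)
    calc spectralNorm₂ (Matrix.hadamard Δ (Q.distinguisher v))
        ≤ spectralNorm₂ ((Matrix.hadamard Δ (Q.distinguisher v)).submatrix e e) :=
          spectralNorm₂_le_submatrix _ he fun a b h => by
            rw [Matrix.hadamard_apply, hΔ0 a b h, zero_mul]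
      _ ≤ spectralNorm₂ (∑ i ∈ s, Matrix.hadamard Γ (P.distinguisher i)) := by
          refine spectralNorm₂_mono (fun x y => ?_) fun x y => ?_
          · rw [Matrix.submatrix_apply, Matrix.hadamard_apply, hΔ]
            exact mul_nonneg (hΓ.nonneg x y) (Q.distinguisher_nonneg v _ _)
          · rw [Matrix.submatrix_apply, Matrix.hadamard_apply, hΔ, Matrix.sum_apply]
            by_cases hv : (e x).1 v = (e y).1 v
            · rw [distinguisher, if_pos hv, mul_zero]
              exact Finset.sum_nonneg fun i _ => h0 i x y
            · obtain ⟨i, his, hi⟩ : ∃ i ∈ s, x.1 i ≠ y.1 i := by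
                by_contra! hc
                exact hv (hdet x y hc)
              refine le_trans (le_of_eq ?_)
                (Finset.single_le_sum (f := fun i => Matrix.hadamard Γ (P.distinguisher i) x y)
                  (fun i _ => h0 i x y) his)
              simp [Matrix.hadamard_apply, distinguisher, hi, hv]
      _ ≤ ∑ i ∈ s, spectralNorm₂ (Matrix.hadamard Γ (P.distinguisher i)) :=
          spectralNorm₂_sum_le _ _
      _ ≤ ∑ _i ∈ s, M := Finset.sum_le_sum fun i _ => hMle i
      _ = s.card * M := by rw [Finset.sum_const, nsmul_eq_mul]
      _ ≤ c * M := mul_le_mul_of_nonneg_right (by exact_mod_cast hs) hM0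
  refine le_trans ?_ (mul_le_mul_of_nonneg_left
    (le_csSup Q.bddAbove_adversaryRatios ⟨Δ, hadv, rfl⟩) (Nat.cast_nonneg c))
  rw [adversaryRatio, adversaryRatio, ← hM, ← hM']
  rcases hM'0.eq_or_lt with h | h
  -- Here the ratio of `Δ` is a division by zero, so `Γ` itself has to vanish.
  · have hz : Δ = 0 := hadv.eq_zero fun v =>
      le_antisymm ((hM'le v).trans_eq h.symm) (spectralNorm₂_nonneg _)
    have : spectralNorm₂ Γ = 0 := le_antisymm
      (hnorm.trans_eq (by rw [hz, spectralNorm₂_zero])) (spectralNorm₂_nonneg _)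
    rw [this, ← h]; simp
  · have hMpos : 0 < M := by
      rcases hM0.eq_or_lt with h' | h'
      · rw [← h', mul_zero] at hkey
        exact absurd (h.trans_le hkey) (lt_irrefl _)
      · exact h'
    rw [mul_div_assoc', div_le_div_iff₀ hMpos h]
    calc spectralNorm₂ Γ * M' ≤ spectralNorm₂ Δ * (c * M) :=
          mul_le_mul hnorm hkey hM'0 (spectralNorm₂_nonneg _)
      _ = _ := by ring

end QueryProblem

/-! ### Herringbone functions -/

/-- One step of the herringbone function with spine `u` and fixed point on the antidiagonal `t`.
The spine meets the antidiagonal `x + y = s` in the point `(u s, s - u s)`. -/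
def herringboneStep (u : ℕ → ℕ) (t x y : ℕ) : ℕ × ℕ :=
  if x < u (x + y) then (x + 1, y - 1)
  else if u (x + y) < x then (x - 1, y + 1)
  else if x + y < t then (u (x + y + 1), x + y + 1 - u (x + y + 1))
  else if t < x + y then (u (x + y - 1), x + y - 1 - u (x + y - 1))
  else (x, y)

/-- The spine is a monotone lattice path from `(0, 0)` to `(N - 1, N - 1)`. -/
structure IsSpine (N : ℕ) (u : ℕ → ℕ) : Prop where
  zero : u 0 = 0
  le_succ : ∀ s, u s ≤ u (s + 1)
  succ_le : ∀ s, u (s + 1) ≤ u s + 1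
  fst_lt : ∀ s, s ≤ 2 * N - 2 → u s < N
  snd_lt : ∀ s, s ≤ 2 * N - 2 → s < u s + N

namespace IsSpine

variable {N : ℕ} {u : ℕ → ℕ}

theorem le_self (h : IsSpine N u) (s : ℕ) : u s ≤ s := by
  induction s with
  | zero => exact h.zero.le
  | succ s ih => have := h.succ_le s; omega

theorem pred (h : IsSpine N u) (s : ℕ) : u (s - 1) ≤ u s ∧ u s ≤ u (s - 1) + 1 := by
  cases s with
  | zero => simp
  | succ s => exact ⟨h.le_succ s, h.succ_le s⟩

/-- The spine advances by one unit right or up per antidiagonal, so a unit step of the point never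
leads from strictly one side of the spine to strictly the other. The remaining cases compare
neighbouring points directly. -/
theorem step_le_right (h : IsSpine N u) (t x y : ℕ) :
    herringboneStep u t x y ≤ herringboneStep u t (x + 1) y := by
  have e1 : x + 1 + y = x + y + 1 := by omega
  have h1 := h.le_succ (x + y)
  have h2 := h.succ_le (x + y)
  have h3 := h.le_succ (x + y + 1)
  have h4 := h.succ_le (x + y + 1)
  have h5 := h.pred (x + y)
  have h6 := h.le_self (x + y)
  have h7 := h.le_self (x + y + 1)
  have h8 := h.le_self (x + y - 1)
  have h9 := h.le_self (x + y + 1 + 1)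
  simp only [herringboneStep, e1, Nat.add_sub_cancel]
  split_ifs <;> simp only [Prod.mk_le_mk] <;> omega

theorem step_le_up (h : IsSpine N u) (t x y : ℕ) :
    herringboneStep u t x y ≤ herringboneStep u t x (y + 1) := by
  have e1 : x + (y + 1) = x + y + 1 := by omega
  have h1 := h.le_succ (x + y)
  have h2 := h.succ_le (x + y)
  have h3 := h.le_succ (x + y + 1)
  have h4 := h.succ_le (x + y + 1)
  have h5 := h.pred (x + y)
  have h6 := h.le_self (x + y)
  have h7 := h.le_self (x + y + 1)
  have h8 := h.le_self (x + y - 1)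
  have h9 := h.le_self (x + y + 1 + 1)
  simp only [herringboneStep, e1, Nat.add_sub_cancel]
  split_ifs <;> simp only [Prod.mk_le_mk] <;> omega

theorem step_mono (h : IsSpine N u) (t : ℕ) {x y x' y' : ℕ} (hx : x ≤ x') (hy : y ≤ y') :
    herringboneStep u t x y ≤ herringboneStep u t x' y' :=
  (monotone_nat_of_le_succ (f := fun x => herringboneStep u t x y)
    (fun x => h.step_le_right t x y) hx).trans
  (monotone_nat_of_le_succ (f := fun y => herringboneStep u t x' y)
    (fun y => h.step_le_up t x' y) hy)

theorem step_lt (h : IsSpine N u) {t x y : ℕ} (ht : t ≤ 2 * N - 2) (hx : x < N) (hy : y < N) :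
    (herringboneStep u t x y).1 < N ∧ (herringboneStep u t x y).2 < N := by
  have h1 := h.fst_lt (x + y) (by omega)
  have h2 := h.snd_lt (x + y) (by omega)
  have h3 := h.fst_lt (x + y - 1) (by omega)
  have h4 := h.snd_lt (x + y - 1) (by omega)
  have h5 := h.fst_lt (x + y + 1)
  have h6 := h.snd_lt (x + y + 1)
  simp only [herringboneStep]
  split_ifs <;> simp only <;> omega

/-- Exactly the point of the spine on the antidiagonal `t` is fixed. -/
theorem step_eq_self_iff (h : IsSpine N u) (t x y : ℕ) :
    herringboneStep u t x y = (x, y) ↔ x + y = t ∧ u t = x := by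
  have h7 := h.le_self (x + y + 1)
  have h8 := h.le_self (x + y - 1)
  constructor
  · intro heq
    have key : x + y = t ∧ u (x + y) = x := by
      simp only [herringboneStep] at heq
      split_ifs at heq <;> simp only [Prod.mk.injEq] at heq <;> omega
    exact ⟨key.1, key.1 ▸ key.2⟩
  · rintro ⟨rfl, hu⟩
    simp [herringboneStep, hu]

/-- The step determines whether a point is on the spine. -/
theorem eq_of_step_eq {u' : ℕ → ℕ} {t t' x y : ℕ} (h : IsSpine N u) (h' : IsSpine N u')
    (heq : herringboneStep u t x y = herringboneStep u' t' x y) (hu : u (x + y) = x) :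
    u' (x + y) = x := by
  -- Off the spine a step stays on its antidiagonal but moves the point; on the spine it changes the
  -- antidiagonal or fixes the point. The bounds keep the truncated subtractions exact.
  have h6 := h'.le_self (x + y)
  have h7 := h.le_self (x + y + 1)
  have h8 := h.le_self (x + y - 1)
  simp only [herringboneStep, hu, lt_irrefl, if_false] at heq
  split_ifs at heq <;> simp only [Prod.mk.injEq] at heq <;> omega

end IsSpine

/-- The herringbone function on the grid. -/
def herringbone {N : ℕ} {u : ℕ → ℕ} (h : IsSpine N u) {t : ℕ} (ht : t ≤ 2 * N - 2) :
    Grid N 2 → Grid N 2 := fun v =>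
  ![⟨_, (h.step_lt ht (v 0).2 (v 1).2).1⟩, ⟨_, (h.step_lt ht (v 0).2 (v 1).2).2⟩]

section

variable {N : ℕ} {u u' : ℕ → ℕ} {t t' : ℕ}

theorem herringbone_apply_eq_iff (h : IsSpine N u) (ht : t ≤ 2 * N - 2) (v w : Grid N 2) :
    herringbone h ht v = w ↔
      herringboneStep u t (v 0) (v 1) = ((w 0 : ℕ), (w 1 : ℕ)) := by
  rw [funext_iff, Fin.forall_fin_two, Prod.ext_iff, Fin.ext_iff, Fin.ext_iff]
  rfl

theorem herringbone_eq_iff (h : IsSpine N u) (h' : IsSpine N u') (ht : t ≤ 2 * N - 2)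
    (ht' : t' ≤ 2 * N - 2) (v : Grid N 2) :
    herringbone h ht v = herringbone h' ht' v ↔
      herringboneStep u t (v 0) (v 1) = herringboneStep u' t' (v 0) (v 1) :=
  herringbone_apply_eq_iff _ _ _ _

theorem herringbone_monotone (h : IsSpine N u) (ht : t ≤ 2 * N - 2) :
    Monotone (herringbone h ht) := by
  intro v w hvw
  have := h.step_mono t (hvw 0) (hvw 1)
  rw [Pi.le_def, Fin.forall_fin_two]
  exact this

theorem herringbone_fixed_iff (h : IsSpine N u) (ht : t ≤ 2 * N - 2) (v : Grid N 2) :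
    herringbone h ht v = v ↔ (v 0 : ℕ) + v 1 = t ∧ u t = v 0 := by
  rw [herringbone_apply_eq_iff, h.step_eq_self_iff]

theorem IsSpine.exists_point (h : IsSpine N u) {s : ℕ} (hs : s ≤ 2 * N - 2) :
    ∃ v : Grid N 2, (v 0 : ℕ) + v 1 = s ∧ u s = v 0 := by
  have h1 := h.fst_lt s hs
  have h2 := h.snd_lt s hs
  have h3 := h.le_self s
  exact ⟨![⟨u s, h1⟩, ⟨s - u s, by omega⟩], by simp; omega, by simp⟩

theorem herringbone_existsUnique (h : IsSpine N u) (ht : t ≤ 2 * N - 2) :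
    ∃! v, herringbone h ht v = v := by
  obtain ⟨v, hv⟩ := h.exists_point ht
  refine ⟨v, (herringbone_fixed_iff h ht v).2 hv, fun w hw => ?_⟩
  obtain ⟨hw1, hw2⟩ := (herringbone_fixed_iff h ht w).1 hw
  rw [funext_iff, Fin.forall_fin_two, Fin.ext_iff, Fin.ext_iff]
  omega

/-- The herringbone function determines the spine and the antidiagonal of the fixed point. -/
theorem herringbone_injective (h : IsSpine N u) (h' : IsSpine N u') (ht : t ≤ 2 * N - 2)
    (ht' : t' ≤ 2 * N - 2) (heq : herringbone h ht = herringbone h' ht') :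
    t = t' ∧ ∀ s ≤ 2 * N - 2, u s = u' s := by
  constructor
  · obtain ⟨v, hv, -⟩ := herringbone_existsUnique h ht
    have h1 := (herringbone_fixed_iff h ht v).1 hv
    have h2 := (herringbone_fixed_iff h' ht' v).1 (heq ▸ hv)
    omega
  · intro s hs
    obtain ⟨v, hv, huv⟩ := h.exists_point hs
    have hstep := (herringbone_eq_iff h h' ht ht' v).1 (congrFun heq v)
    have := h.eq_of_step_eq h' hstep (by rw [hv, huv])
    rw [hv] at this
    omega

end

/-! ### The spine encoding the hidden positions -/

/-- The offset of the spine while it moves from `a` to `b`. The move takes place in the period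
number `a`, and `τ` is the time since the start of the period `j`. -/
def crossing (j τ a b : ℕ) : ℕ :=
  if j < a then a else if a < j then b else max (j - τ / 2) (min (j + (τ + 1) / 2) b)

/-- The offset of the spine from the diagonal, on the antidiagonal `s`. After an initial segment
of length `2 * (n - 1)`, there are `n` periods of length `2 * n` for the move from each `p i` to
`p (i + 1)`. -/
def spineOffset (n : ℕ) (p : ℕ → ℕ) (s : ℕ) : ℕ :=
  crossing ((s - 2 * (n - 1)) / (2 * n) % n) ((s - 2 * (n - 1)) % (2 * n))
    (p ((s - 2 * (n - 1)) / (2 * n) / n)) (p ((s - 2 * (n - 1)) / (2 * n) / n + 1))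

/-- The spine with the positions `p`. -/
def spine (N n : ℕ) (p : ℕ → ℕ) (s : ℕ) : ℕ :=
  min s (min (N - 1) (s / 2 + spineOffset n p s))

/-- The antidiagonal of the fixed point for the answer `k`. -/
def fixedLevel (n k : ℕ) : ℕ := 2 * (n - 1) + (2 * (n * (n * k)) - 2)

theorem crossing_lt {n j τ a b : ℕ} (ha : a < n) (hb : b < n) : crossing j τ a b < n := by
  unfold crossing
  split_ifs <;> omega

/-- The offset changes by one every two antidiagonals and has at most `n - 1` to go, so time `2 * (n
- 1)` suffices. -/
theorem crossing_stable {n j τ a b : ℕ} (hj : j < n) (hb : b < n) (hτ : 2 * (n - 1) ≤ τ) :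
    crossing j τ a b = if j < a then a else b := by
  unfold crossing
  split_ifs <;> omega

theorem spineOffset_of_le {n : ℕ} (p : ℕ → ℕ) {s : ℕ} (hs : s ≤ 2 * (n - 1)) :
    spineOffset n p s = p 0 := by
  simp only [spineOffset, Nat.sub_eq_zero_of_le hs, Nat.zero_div, Nat.zero_mod, crossing]
  split_ifs <;> omega

theorem spineOffset_eq_of_lt {n : ℕ} (p : ℕ → ℕ) {i j τ : ℕ} (hj : j < n) (hτ : τ < 2 * n) :
    spineOffset n p (2 * (n - 1) + 2 * n * (n * i + j) + τ) = crossing j τ (p i) (p (i + 1)) := by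
  have e1 : 2 * (n - 1) + 2 * n * (n * i + j) + τ - 2 * (n - 1) = 2 * n * (n * i + j) + τ := by
    omega
  have e2 : (2 * n * (n * i + j) + τ) / (2 * n) = n * i + j := by
    rw [Nat.mul_add_div (by omega), Nat.div_eq_of_lt hτ, add_zero]
  have e3 : (2 * n * (n * i + j) + τ) % (2 * n) = τ := by
    rw [Nat.mul_add_mod, Nat.mod_eq_of_lt hτ]
  have e4 : (n * i + j) / n = i := by
    rw [Nat.mul_add_div (by omega), Nat.div_eq_of_lt hj, add_zero]
  have e5 : (n * i + j) % n = j := by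
    rw [Nat.mul_add_mod, Nat.mod_eq_of_lt hj]
  rw [spineOffset, e1, e2, e3, e4, e5]

theorem spineOffset_eq {n : ℕ} {p : ℕ → ℕ} (hp : ∀ i, p i < n) {i j τ : ℕ} (hj : j < n)
    (hτ : τ ≤ 2 * n) :
    spineOffset n p (2 * (n - 1) + 2 * n * (n * i + j) + τ) = crossing j τ (p i) (p (i + 1)) := by
  rcases hτ.lt_or_eq with hτ | rfl
  · exact spineOffset_eq_of_lt p hj hτ
  -- Time `2 * n` is the start of the next period, or of the next stage if `j = n - 1`. The move has
  -- settled by then, so both formulas agree.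
  have h0 := hp i
  rw [crossing_stable hj (hp _) (by omega)]
  by_cases hj' : j + 1 < n
  · have e : 2 * (n - 1) + 2 * n * (n * i + j) + 2 * n =
        2 * (n - 1) + 2 * n * (n * i + (j + 1)) + 0 := by ring
    rw [e, spineOffset_eq_of_lt p hj' (by omega), crossing]
    split_ifs <;> omega
  · have e : 2 * (n - 1) + 2 * n * (n * i + j) + 2 * n =
        2 * (n - 1) + 2 * n * (n * (i + 1) + 0) + 0 := by
      obtain rfl : n = j + 1 := by omega
      ring
    rw [e, spineOffset_eq_of_lt p (by omega) (by omega), crossing]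
    split_ifs <;> omega

/-- Every antidiagonal beyond the initial segment belongs to a period. -/
theorem exists_period {n s : ℕ} (hn : 0 < n) (hs : 2 * (n - 1) ≤ s) :
    ∃ i j τ, j < n ∧ τ < 2 * n ∧ s = 2 * (n - 1) + 2 * n * (n * i + j) + τ := by
  refine ⟨(s - 2 * (n - 1)) / (2 * n) / n, (s - 2 * (n - 1)) / (2 * n) % n,
    (s - 2 * (n - 1)) % (2 * n), Nat.mod_lt _ hn, Nat.mod_lt _ (by omega), ?_⟩
  rw [Nat.div_add_mod, add_assoc, Nat.div_add_mod]
  omega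

theorem spineOffset_lt {n : ℕ} {p : ℕ → ℕ} (hp : ∀ i, p i < n) (s : ℕ) :
    spineOffset n p s < n :=
  crossing_lt (hp _) (hp _)

/-- Two consecutive steps around the antidiagonal `s` belong to the same period. -/
theorem spineOffset_local {n : ℕ} (hn : 2 ≤ n) (s : ℕ) :
    ∃ i j τ' τ τ'', j < n ∧ τ' ≤ τ ∧ τ ≤ τ'' ∧ τ'' ≤ τ + 1 ∧
      (s < 2 * (n - 1) ∧ i = 0 ∧ j = 0 ∧ τ = 0 ∧ τ'' = 0 ∨
        s = 2 * (n - 1) + 2 * n * (n * i + j) + τ ∧ τ < 2 * n) ∧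
      ∀ p : ℕ → ℕ, (∀ i, p i < n) →
        spineOffset n p (s - 1) = crossing j τ' (p i) (p (i + 1)) ∧
        spineOffset n p s = crossing j τ (p i) (p (i + 1)) ∧
        spineOffset n p (s + 1) = crossing j τ'' (p i) (p (i + 1)) := by
  have h00 : ∀ p : ℕ → ℕ, crossing 0 0 (p 0) (p (0 + 1)) = p 0 := fun p => by
    unfold crossing
    split_ifs <;> omega
  by_cases hs : s < 2 * (n - 1)
  · refine ⟨0, 0, 0, 0, 0, by omega, le_rfl, le_rfl, by omega, Or.inl ⟨hs, rfl, rfl, rfl, rfl⟩,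
      fun p _ => ?_⟩
    rw [spineOffset_of_le p hs.le, spineOffset_of_le (s := s - 1) p (by omega),
      spineOffset_of_le (s := s + 1) p (by omega), h00]
    exact ⟨rfl, rfl, rfl⟩
  · obtain ⟨i, j, τ, hj, hτ, rfl⟩ := exists_period (n := n) (s := s) (by omega) (by omega)
    refine ⟨i, j, τ - 1, τ, τ + 1, hj, by omega, by omega, le_rfl, Or.inr ⟨rfl, hτ⟩,
      fun p hp => ⟨?_, spineOffset_eq hp hj hτ.le, ?_⟩⟩
    swap
    · rw [add_assoc _ τ 1]
      exact spineOffset_eq hp hj (by omega)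
    -- At `τ = 0` the previous antidiagonal lies in the preceding period or the initial segment. Its
    -- offset is already the one with which this period starts, so `τ' = 0` is correct.
    rcases Nat.eq_zero_or_pos τ with rfl | hτ0
    · have h0 := hp i
      rcases Nat.eq_zero_or_pos j with rfl | hj0
      · cases i with
        | zero =>
          rw [spineOffset_of_le p (by simp)]
          exact (h00 p).symm
        | succ i =>
          have e : 2 * (n - 1) + 2 * n * (n * (i + 1) + 0) + 0 - 1 =
              2 * (n - 1) + 2 * n * (n * i + (n - 1)) + (2 * n - 1) := by
            obtain ⟨m, rfl⟩ : ∃ m, n = m + 1 := ⟨n - 1, by omega⟩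
            simp only [Nat.add_sub_cancel]
            have : 2 * (m + 1) * ((m + 1) * (i + 1) + 0) =
              2 * (m + 1) * ((m + 1) * i + m) + 2 * (m + 1) := by ring
            omega
          have h1 := hp i
          rw [e, spineOffset_eq hp (by omega) (by omega),
            crossing_stable (n := n) (by omega) (hp _) (by omega), crossing]
          split_ifs <;> omega
      · have e : 2 * (n - 1) + 2 * n * (n * i + j) + 0 - 1 =
            2 * (n - 1) + 2 * n * (n * i + (j - 1)) + (2 * n - 1) := by
          obtain ⟨m, rfl⟩ : ∃ m, j = m + 1 := ⟨j - 1, by omega⟩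
          simp only [Nat.add_sub_cancel]
          have : 2 * n * (n * i + (m + 1)) = 2 * n * (n * i + m) + 2 * n := by ring
          omega
        rw [e, spineOffset_eq hp (by omega) (by omega),
          crossing_stable (n := n) (by omega) (hp _) (by omega), crossing]
        split_ifs <;> omega
    · have e : 2 * (n - 1) + 2 * n * (n * i + j) + τ - 1 =
          2 * (n - 1) + 2 * n * (n * i + j) + (τ - 1) := by omega
      rw [e, spineOffset_eq hp hj (by omega)]

theorem spineOffset_fixedLevel {n : ℕ} (hn : 2 ≤ n) {p : ℕ → ℕ} (hp : ∀ i, p i < n) (k : ℕ) :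
    spineOffset n p (fixedLevel n k) = p k := by
  cases k with
  -- For `k = 0` truncated subtraction puts the level at the end of the initial segment.
  | zero => exact spineOffset_of_le p (by simp [fixedLevel])
  | succ k =>
    have e : fixedLevel n (k + 1) = 2 * (n - 1) + 2 * n * (n * k + (n - 1)) + 2 * (n - 1) := by
      obtain ⟨m, rfl⟩ : ∃ m, n = m + 1 := ⟨n - 1, by omega⟩
      simp only [fixedLevel, Nat.add_sub_cancel]
      have : 2 * ((m + 1) * ((m + 1) * (k + 1))) =
        2 * (m + 1) * ((m + 1) * k + m) + 2 * m + 2 := by ring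
      omega
    have h0 := hp k
    rw [e, spineOffset_eq hp (by omega) (by omega),
      crossing_stable (n := n) (by omega) (hp _) le_rfl, if_neg (by omega)]

/-- Periods start on even antidiagonals, so `τ` and `s` have the same parity. A decrease of the
offset coincides with an increase of `s / 2` and cancels it; an increase of the offset falls where
`s / 2` is constant. While the offset changes, the spine therefore runs straight up or straight
right. -/
theorem halfStep_spineOffset {n : ℕ} (hn : 2 ≤ n) {p : ℕ → ℕ} (hp : ∀ i, p i < n) (s : ℕ) :
    s / 2 + spineOffset n p s ≤ (s + 1) / 2 + spineOffset n p (s + 1) ∧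
      (s + 1) / 2 + spineOffset n p (s + 1) ≤ s / 2 + spineOffset n p s + 1 := by
  by_cases hs : s < 2 * (n - 1)
  · rw [spineOffset_of_le p hs.le, spineOffset_of_le (s := s + 1) p (by omega)]
    omega
  · obtain ⟨i, j, τ, hj, hτ, rfl⟩ := exists_period (n := n) (s := s) (by omega) (by omega)
    have e := spineOffset_eq hp (i := i) hj (by omega : τ + 1 ≤ 2 * n)
    rw [spineOffset_eq hp hj hτ.le, add_assoc _ τ 1, e, mul_assoc]
    generalize n * (n * i + j) = m
    have h1 := hp (i + 1)
    unfold crossing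
    split_ifs <;> omega

theorem isSpine_spine {N n : ℕ} (hn : 2 ≤ n) (hN : n < N) {p : ℕ → ℕ} (hp : ∀ i, p i < n) :
    IsSpine N (spine N n p) where
  zero := by simp [spine]
  le_succ s := by
    have := halfStep_spineOffset hn hp s
    unfold spine
    omega
  succ_le s := by
    have := halfStep_spineOffset hn hp s
    unfold spine
    omega
  fst_lt s hs := by
    unfold spine
    omega
  snd_lt s hs := by
    unfold spine
    omega

theorem fixedLevel_strictMono {n : ℕ} (hn : 2 ≤ n) : StrictMono (fixedLevel n) := by
  refine strictMono_nat_of_lt_succ fun k => ?_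
  have h1 : n * (n * (k + 1)) = n * (n * k) + n * n := by ring
  have h2 : 4 ≤ n * n := Nat.mul_le_mul hn hn
  unfold fixedLevel
  omega

/-- This is what fixes the grid size: up to the last fixed level the spine is not cut off by the
right edge, whatever the offset. For `k = n` the bound on `N` is exactly what is needed. -/
theorem fixedLevel_bound {N n : ℕ} (hN : n * n * n + 2 * n - 2 ≤ N) (hn : 2 ≤ n) {k : ℕ}
    (hk : k ≤ n) : fixedLevel n k / 2 + (n - 1) ≤ N - 1 := by
  have h1 : n * (n * k) ≤ n * n * n := by
    rw [mul_assoc]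
    exact Nat.mul_le_mul_left _ (Nat.mul_le_mul_left _ hk)
  have h2 : 4 * 2 ≤ n * n * n := Nat.mul_le_mul (Nat.mul_le_mul hn hn) hn
  unfold fixedLevel
  omega

theorem spine_fixedLevel {N n : ℕ} (hN : n * n * n + 2 * n - 2 ≤ N) (hn : 2 ≤ n) {p : ℕ → ℕ}
    (hp : ∀ i, p i < n) {k : ℕ} (hk : k ≤ n) :
    spine N n p (fixedLevel n k) = fixedLevel n k / 2 + p k := by
  have h1 := fixedLevel_bound hN hn hk
  have h2 := hp k
  have h3 : 2 * (n - 1) ≤ fixedLevel n k := by unfold fixedLevel; omega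
  rw [spine, spineOffset_fixedLevel hn hp]
  omega

/-! ### Three responses determine a herringbone step -/

/-- Block `i` of the nested search has the hidden symbol at position `a` and the answer is `k` in
one input, and these are `a'` and `k'` in the other one. Both give the same response to the query
at position `j` of the block. -/
def SameResponse (i j a k a' k' : ℕ) : Prop :=
  (a < j ↔ a' < j) ∧ (j < a ↔ j < a') ∧ (a = j → (i < k ↔ i < k') ∧ (k < i ↔ k' < i))

theorem sameResponse_of_hsosString_eq {m n : ℕ} {i k k' : Fin m} {j a a' : Fin n}
    (h : hsosString n a (osString m k i) j = hsosString n a' (osString m k' i) j) :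
    SameResponse i j a k a' k' := by
  simp only [hsosString, osString] at h
  simp only [SameResponse, ← Fin.lt_def, ← Fin.ext_iff]
  split_ifs at h <;> simp only [HSSymbol.hidden.injEq, reduceCtorEq] at h <;> omega

/-- How the antidiagonal of the fixed point compares with an antidiagonal of a given period. -/
theorem fixedLevel_compare {n i j τ k s : ℕ} (hn : 2 ≤ n) (hj : j < n) (hτ : τ < 2 * n)
    (hs : s = 2 * (n - 1) + 2 * n * (n * i + j) + τ) :
    (k ≤ i → fixedLevel n k ≤ s ∧ (fixedLevel n k = s → k = 0 ∧ i = 0 ∧ j = 0)) ∧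
      (i + 2 ≤ k → s < fixedLevel n k) ∧
      (k = i + 1 → (s < fixedLevel n k ↔ j < n - 1 ∨ τ < 2 * (n - 1))) := by
  have e : 2 * n * (n * i + j) = 2 * (n * (n * i)) + 2 * (n * j) := by ring
  have hQ : 4 ≤ n * n := Nat.mul_le_mul hn hn
  have hJ : n * j + n ≤ n * n := by nlinarith
  have hJ1 : j < n - 1 → n * j + 2 * n ≤ n * n := fun h => by
    have : j + 2 ≤ n := by omega
    nlinarith
  have hJ2 : ¬ j < n - 1 → n * j + n = n * n := fun h => by
    obtain rfl : n = j + 1 := by omega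
    ring
  have hJ0 : 0 < j → n ≤ n * j := fun h => Nat.le_mul_of_pos_right n h
  have hI0 : 0 < i → n * n ≤ n * (n * i) := fun h =>
    Nat.mul_le_mul_left n (Nat.le_mul_of_pos_right n h)
  have hK0 : 0 < k → n * n ≤ n * (n * k) := fun h =>
    Nat.mul_le_mul_left n (Nat.le_mul_of_pos_right n h)
  have hmul : ∀ {u v : ℕ}, u ≤ v → n * (n * u) ≤ n * (n * v) := fun h =>
    Nat.mul_le_mul_left n (Nat.mul_le_mul_left n h)
  rw [e] at hs
  refine ⟨fun h => ?_, fun h => ?_, fun h => ?_⟩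
  · have := hmul h
    unfold fixedLevel
    omega
  · have := hmul h
    have e2 : n * (n * (i + 2)) = n * (n * i) + 2 * (n * n) := by ring
    unfold fixedLevel
    omega
  · have e2 : n * (n * (i + 1)) = n * (n * i) + n * n := by ring
    rw [h, fixedLevel, e2]
    by_cases hj' : j < n - 1
    · have := hJ1 hj'
      omega
    · have := hJ2 hj'
      omega

/-- In the period of the move the offset is `b` clamped to an interval depending only on `j` and
`τ`, so its comparison with `d` follows from that of `b` with `d`. In every other period it is `a`
or `b` itself. -/
theorem crossing_compare {j τ a b a' b' d : ℕ} (h1 : a < j ↔ a' < j) (h2 : j < a ↔ j < a')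
    (h3 : a < d ↔ a' < d) (h4 : d < a ↔ d < a') (h5 : b < d ↔ b' < d) (h6 : d < b ↔ d < b') :
    (crossing j τ a b < d ↔ crossing j τ a' b' < d) ∧
      (d < crossing j τ a b ↔ d < crossing j τ a' b') := by
  unfold crossing
  split_ifs <;> omega

/-- If the moving offset is at `d`, its next step depends only on whether `b` is below, at or above
`d`, since the offset changes by at most one. Earlier times retrace the path from `j` to `d`. -/
theorem crossing_eq_of_near {j τ a b a' b' d σ : ℕ} (h1 : a < j ↔ a' < j)
    (h2 : j < a ↔ j < a') (h3 : a < d ↔ a' < d) (h4 : d < a ↔ d < a') (h5 : b < d ↔ b' < d)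
    (h6 : d < b ↔ d < b') (hd : crossing j τ a b = d) (hσ : σ ≤ τ + 1) :
    crossing j σ a b = crossing j σ a' b' := by
  unfold crossing at *
  split_ifs at * <;> omega

theorem crossing_self (j τ a : ℕ) : crossing j τ a a = a := by
  unfold crossing
  split_ifs <;> omega

/-- If the move is over, then `b = d` and the third response compares `k` with `i + 1`. Otherwise
the first or the second response reveals a hidden symbol and compares `k` with `i`. This leaves only
`i < k` at the very end of the stage open; there the offset has settled at `b = d`, and the third
response decides. -/
theorem fixedLevel_compare_iff {n i j τ k k' a b a' b' s d : ℕ} (hn : 2 ≤ n) (hj : j < n)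
    (hτ : τ < 2 * n) (hs : s = 2 * (n - 1) + 2 * n * (n * i + j) + τ) (ha : a < n) (hb : b < n)
    (h1 : SameResponse i j a k a' k') (h2 : SameResponse i d a k a' k')
    (h3 : SameResponse (i + 1) d b k b' k') (hd : crossing j τ a b = d) :
    (s < fixedLevel n k ↔ s < fixedLevel n k') ∧ (fixedLevel n k < s ↔ fixedLevel n k' < s) := by
  have hbelow : ∀ {l l'}, fixedLevel n l < s → fixedLevel n l' < s →
      (s < fixedLevel n l ↔ s < fixedLevel n l') ∧ (fixedLevel n l < s ↔ fixedLevel n l' < s) :=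
    fun h h' => ⟨iff_of_false h.not_gt h'.not_gt, iff_of_true h h'⟩
  have habove : ∀ {l l'}, s < fixedLevel n l → s < fixedLevel n l' →
      (s < fixedLevel n l ↔ s < fixedLevel n l') ∧ (fixedLevel n l < s ↔ fixedLevel n l' < s) :=
    fun h h' => ⟨iff_of_true h h', iff_of_false h.not_gt h'.not_gt⟩
  have hle : ∀ {l}, l ≤ i → (l < i ∨ 0 < j) → fixedLevel n l < s := fun {l} hl h => by
    obtain ⟨h1, h2⟩ := (fixedLevel_compare (k := l) hn hj hτ hs).1 hl
    exact lt_of_le_of_ne h1 fun heq => by have := h2 heq; omega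
  have hge : ∀ {l}, i + 2 ≤ l → s < fixedLevel n l := fun {l} =>
    (fixedLevel_compare (k := l) hn hj hτ hs).2.1
  have hmid := (fixedLevel_compare (k := i + 1) hn hj hτ hs).2.2 rfl
  obtain ⟨-, -, h1⟩ := h1
  obtain ⟨-, -, h2⟩ := h2
  obtain ⟨-, -, h3⟩ := h3
  by_cases hlt : a < j
  · have hbd : b = d := by rw [← hd, crossing, if_neg (by omega), if_pos hlt]
    obtain ⟨g1, g2⟩ := h3 hbd
    rcases lt_trichotomy k (i + 1) with hk | rfl | hk
    · exact hbelow (hle (by omega) (by omega)) (hle (by omega) (by omega))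
    · obtain rfl : k' = i + 1 := by omega
      exact ⟨Iff.rfl, Iff.rfl⟩
    · exact habove (hge hk) (hge (g1.1 hk))
  · have hik : (i < k ↔ i < k') ∧ (k < i ↔ k' < i) := by
      by_cases haj : a = j
      · exact h1 haj
      · exact h2 (by rw [← hd, crossing, if_pos (by omega)])
    rcases lt_trichotomy k i with hk | rfl | hk
    · have hk' := hik.2.1 hk
      exact hbelow (hle hk.le (Or.inl hk)) (hle hk'.le (Or.inl hk'))
    · obtain rfl : k' = k := by omega
      exact ⟨Iff.rfl, Iff.rfl⟩
    have hk' := hik.1.1 hk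
    by_cases hlate : j < n - 1 ∨ τ < 2 * (n - 1)
    · have hall : ∀ {l}, i < l → s < fixedLevel n l := fun {l} hl => by
        rcases Nat.lt_or_ge (i + 1) l with h' | h'
        · exact hge h'
        · obtain rfl : l = i + 1 := by omega
          exact hmid.2 hlate
      exact habove (hall hk) (hall hk')
    · have hbd : b = d := by
        rw [← hd, crossing_stable (n := n) hj hb (by omega), if_neg (by omega)]
      obtain ⟨g1, g2⟩ := h3 hbd
      rcases lt_trichotomy k (i + 1) with hk | rfl | hk
      · omega
      · obtain rfl : k' = i + 1 := by omega
        exact ⟨Iff.rfl, Iff.rfl⟩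
      · exact habove (hge hk) (hge (g1.1 hk))

theorem period_lt {n i j τ : ℕ} (hi : i < n) (hj : j < n) (hτ : τ < 2 * n) :
    2 * n * (n * i + j) + τ < 2 * (n * n * n) := by
  have h1 : n * i + j + 1 ≤ n * n :=
    calc n * i + j + 1 ≤ n * i + n := by omega
      _ = n * (i + 1) := by ring
      _ ≤ n * n := Nat.mul_le_mul_left n hi
  calc 2 * n * (n * i + j) + τ < 2 * n * (n * i + j) + 2 * n := by omega
    _ = 2 * n * (n * i + j + 1) := by ring
    _ ≤ 2 * n * (n * n) := Nat.mul_le_mul_left _ h1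
    _ = 2 * (n * n * n) := by ring

/-- The spine runs along the boundary of the grid where its offset is too large. -/
theorem spine_of_ge {N n : ℕ} {p : ℕ → ℕ} {s : ℕ} (h : min s (N - 1) ≤ s / 2 + spineOffset n p s) :
    spine N n p s = min s (N - 1) := by
  unfold spine
  omega

/-- The hidden positions, continued by a constant, and the answer of a nested search. -/
structure IsSearchData (n : ℕ) (p : ℕ → ℕ) (k : ℕ) : Prop where
  lt : ∀ i, p i < n
  stable : ∀ i, n ≤ i → p i = p n
  le : k ≤ n

/-- Two nested searches which give the same responses to the three relevant queries give the same
herringbone step. -/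
theorem herringboneStep_determined {N n : ℕ} (hN : n * n * n + 2 * n - 2 ≤ N) (hn : 2 ≤ n)
    {x y : ℕ} (hx : x < N) (hy : y < N) :
    ∃ i i' j d, i ≤ n ∧ i' ≤ n ∧ j < n ∧ d < n ∧ ∀ p k p' k', IsSearchData n p k →
      IsSearchData n p' k' → SameResponse i j (p i) k (p' i) k' →
      SameResponse i d (p i) k (p' i) k' → SameResponse i' d (p i') k (p' i') k' →
      herringboneStep (spine N n p) (fixedLevel n k) x y =
        herringboneStep (spine N n p') (fixedLevel n k') x y := by
  obtain ⟨i, j, τ₁, τ, τ₂, hj, hτ₁, hτ, hτ₂, hpos, hloc⟩ := spineOffset_local hn (x + y)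
  -- The queries are the period number in block `i` and the offset of the point in blocks `i` and `i
  -- + 1`. Truncation at `n` is harmless because the positions are constant from there on;
  -- truncation of the offset matters only for points whose side of the spine is known without a
  -- query.
  refine ⟨min i n, min (i + 1) n, j, min (x - (x + y) / 2) (n - 1), min_le_right _ _,
    min_le_right _ _, hj, by omega, fun p k p' k' hp hp' h1 h2 h3 => ?_⟩
  have hmin : ∀ {q l}, IsSearchData n q l → ∀ i, q (min i n) = q i := fun {q l} hq i => by
    rcases le_total i n with h | h
    · rw [min_eq_left h]
    · rw [min_eq_right h, hq.stable i h]
  rw [hmin hp, hmin hp'] at h1 h2 h3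
  obtain ⟨e₁, e, e₂⟩ := hloc p hp.lt
  obtain ⟨e₁', e', e₂'⟩ := hloc p' hp'.lt
  have hpi := hp.lt i
  have hpi' := hp.lt (i + 1)
  have hlt := spineOffset_lt hp.lt (x + y)
  have hlt' := spineOffset_lt hp'.lt (x + y)
  have hlev : 2 * (n - 1) ≤ fixedLevel n k := by unfold fixedLevel; omega
  have hlev' : 2 * (n - 1) ≤ fixedLevel n k' := by unfold fixedLevel; omega
  suffices hmain : (spine N n p (x + y) < x ↔ spine N n p' (x + y) < x) ∧
      (x < spine N n p (x + y) ↔ x < spine N n p' (x + y)) ∧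
      (spine N n p (x + y) = x →
        spine N n p (x + y + 1) = spine N n p' (x + y + 1) ∧
        spine N n p (x + y - 1) = spine N n p' (x + y - 1) ∧
        (x + y < fixedLevel n k ↔ x + y < fixedLevel n k') ∧
        (fixedLevel n k < x + y ↔ fixedLevel n k' < x + y)) by
    obtain ⟨m1, m2, m3⟩ := hmain
    unfold herringboneStep
    by_cases c1 : x < spine N n p (x + y)
    · rw [if_pos c1, if_pos (m2.1 c1)]
    by_cases c2 : spine N n p (x + y) < x
    · rw [if_neg c1, if_neg (mt m2.2 c1), if_pos c2, if_pos (m1.1 c2)]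
    obtain ⟨m4, m5, m6, m7⟩ := m3 (by omega)
    simp only [m1, m2, m4, m5, m6, m7]
  -- The offset of the spine lies in `[0, n)`, so the side of a point outside this strip is the same
  -- for all inputs.
  rcases lt_or_ge x ((x + y) / 2) with hxs | hxs
  · unfold spine
    omega
  rcases le_or_gt n (x - (x + y) / 2) with hdn | hdn
  · unfold spine
    omega
  obtain ⟨d, hd⟩ : ∃ d, x = (x + y) / 2 + d := ⟨x - (x + y) / 2, by omega⟩
  have hmind : min (x - (x + y) / 2) (n - 1) = d := by omega
  rw [hmind] at h2 h3
  obtain ⟨c1, c2⟩ := crossing_compare (τ := τ) h1.1 h1.2.1 h2.1 h2.2.1 h3.1 h3.2.1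
  rw [← e, ← e'] at c1 c2
  refine ⟨by unfold spine; omega, by unfold spine; omega, fun hux => ?_⟩
  have hdle : d ≤ spineOffset n p (x + y) := by
    unfold spine at hux
    omega
  rcases hdle.eq_or_lt with hdo | hdo
  · have hcd : crossing j τ (p i) (p (i + 1)) = d := by rw [← e, hdo]
    have f : spineOffset n p (x + y) = spineOffset n p' (x + y) := by omega
    have f₁ : spineOffset n p (x + y - 1) = spineOffset n p' (x + y - 1) := by
      rw [e₁, e₁']
      exact crossing_eq_of_near h1.1 h1.2.1 h2.1 h2.2.1 h3.1 h3.2.1 hcd (by omega)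
    have f₂ : spineOffset n p (x + y + 1) = spineOffset n p' (x + y + 1) := by
      rw [e₂, e₂']
      exact crossing_eq_of_near h1.1 h1.2.1 h2.1 h2.2.1 h3.1 h3.2.1 hcd (by omega)
    refine ⟨by rw [spine, spine, f₂], by rw [spine, spine, f₁], ?_⟩
    rcases hpos with ⟨hs, -⟩ | ⟨hs, hτn⟩
    · omega
    rcases lt_or_ge i n with hin | hin
    · rw [min_eq_left hin.le] at h1 h2
      rw [min_eq_left hin] at h3
      exact fixedLevel_compare_iff hn hj hτn hs hpi hpi' h1 h2 h3 hcd
    -- Beyond stage `n - 1` every fixed level has been passed.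
    · have k1 := (fixedLevel_compare (k := k) hn hj hτn hs).1 (hp.le.trans hin)
      have k2 := (fixedLevel_compare (k := k') hn hj hτn hs).1 (hp'.le.trans hin)
      omega
  -- The point is on the spine although the offset exceeds `d`: the spine is cut off by the edge of
  -- the grid, in both inputs. It follows that edge on the adjacent antidiagonals too, because the
  -- offset is constant both in the initial segment and beyond stage `n - 1`, the only places where
  -- this happens.
  · have hdo' := c2.1 hdo
    have hsat : x = x + y ∨ x = N - 1 := by
      unfold spine at hux
      omega
    have hedge : ∀ {q q' : ℕ → ℕ} {s}, min s (N - 1) ≤ s / 2 + spineOffset n q s →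
        min s (N - 1) ≤ s / 2 + spineOffset n q' s → spine N n q s = spine N n q' s :=
      fun h h' => by rw [spine_of_ge h, spine_of_ge h']
    clear c1 c2 hux hmind h1 h2 h3
    rcases hpos with ⟨hs, rfl, rfl, rfl, rfl⟩ | ⟨hs, hτn⟩
    · obtain rfl : τ₁ = 0 := by omega
      rw [← e] at e₁ e₂
      rw [← e'] at e₁' e₂'
      clear e e' hloc
      refine ⟨hedge ?_ ?_, hedge ?_ ?_, by omega, by omega⟩ <;> omega
    · have hin : n ≤ i := by
        by_contra hin
        have := period_lt (by omega : i < n) hj hτn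
        clear e₁ e e₂ e₁' e' e₂'
        omega
      have hcross : ∀ {q l}, IsSearchData n q l → ∀ σ, crossing j σ (q i) (q (i + 1)) = q n :=
        fun {q l} hq σ => by
          rw [hq.stable i hin, hq.stable (i + 1) (by omega), crossing_self]
      rw [hcross hp] at e₁ e e₂
      rw [hcross hp'] at e₁' e' e₂'
      have hlow : ∀ {l}, l ≤ n → fixedLevel n l < x + y := fun hl => by
        obtain ⟨k1, k2⟩ := (fixedLevel_compare hn hj hτn hs).1 (hl.trans hin)
        exact lt_of_le_of_ne k1 fun heq => by have := k2 heq; omega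
      have hk := hlow hp.le
      have hk' := hlow hp'.le
      have g0 : 2 * (n - 1) ≤ x + y := hs ▸ by omega
      clear hs hloc
      refine ⟨hedge ?_ ?_, hedge ?_ ?_, by omega, by omega⟩ <;> omega

/-! ### The embedding of nested ordered search -/

/-- An input of the nested search consists of the hidden positions and the answer. -/
theorem nestedOrderedSearch_data {a b : ℕ} (x : (nestedOrderedSearch a b).domain) :
    ∃ pos : Fin a → Fin b,
      ∀ i j, x.1 ⟨i, j⟩ =
        hsosString b (pos i) (osString a ((nestedOrderedSearch a b).answer x) i) j := by
  obtain ⟨x, hx, k, hk⟩ := x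
  have hans : (nestedOrderedSearch a b).answer ⟨x, hx, k, hk⟩ = k := by
    refine Eq.trans ?_ (orderedSearch_answer a k)
    exact congrArg (orderedSearch a).answer (Subtype.ext hk)
  rw [hans]
  choose s pos hpos using fun i => hx i
  refine ⟨pos, fun i j => ?_⟩
  have hs : osString a k i = s i := by
    rw [← congrFun hk i]
    refine Eq.trans ?_ (hiddenSymbolOrderedSearch_answer b (pos i) (s i))
    exact congrArg (hiddenSymbolOrderedSearch b).answer (Subtype.ext (hpos i))
  rw [hs, ← hpos i]

/-- The hidden positions of an input of the nested search, continued by a constant. -/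
noncomputable def hiddenPosition {n : ℕ} (x : (nestedOrderedSearch (n + 1) n).domain) (i : ℕ) :
    ℕ :=
  (nestedOrderedSearch_data x).choose ⟨min i n, by omega⟩

theorem isSearchData {n : ℕ} (x : (nestedOrderedSearch (n + 1) n).domain) :
    IsSearchData n (hiddenPosition x) ((nestedOrderedSearch (n + 1) n).answer x) where
  lt i := Fin.is_lt _
  stable i hi := by simp [hiddenPosition, hi]
  le := Nat.lt_succ_iff.1 (Fin.is_lt _)

theorem hiddenPosition_spec {n : ℕ} (x : (nestedOrderedSearch (n + 1) n).domain) (i : Fin (n + 1)) :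
    ∃ a : Fin n, (a : ℕ) = hiddenPosition x i ∧ ∀ j, x.1 ⟨i, j⟩ =
      hsosString n a (osString (n + 1) ((nestedOrderedSearch (n + 1) n).answer x) i) j := by
  refine ⟨_, ?_, (nestedOrderedSearch_data x).choose_spec i⟩
  have : (⟨min (i : ℕ) n, by omega⟩ : Fin (n + 1)) = i := Fin.ext (by simp; omega)
  rw [hiddenPosition, this]

/-- The hypotheses on `Q` cover both readings: the embedding uses only functions with a unique fixed
point, which every selection rule must return. -/
theorem SA_nestedOrderedSearch_le {N n : ℕ} (hN : n * n * n + 2 * n - 2 ≤ N) (hn : 2 ≤ n)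
    (Q : QueryProblem (Grid N 2) (Grid N 2) (Grid N 2))
    (hdom : ∀ f : Grid N 2 → Grid N 2, Monotone f → (∃! v, f v = v) → f ∈ Q.domain)
    (hans : ∀ f : Q.domain, (∃! v, f.1 v = v) → f.1 (Q.answer f) = Q.answer f) :
    (nestedOrderedSearch (n + 1) n).SA ≤ (7 : ℕ) * Q.SA := by
  classical
  have hnN : n < N := by
    have : 4 * 2 ≤ n * n * n := Nat.mul_le_mul (Nat.mul_le_mul hn hn) hn
    omega
  have hu : ∀ x, IsSpine N (spine N n (hiddenPosition x)) := fun x =>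
    isSpine_spine hn hnN (isSearchData x).lt
  have hlev : ∀ {k}, k ≤ n → fixedLevel n k ≤ 2 * N - 2 := fun hk => by
    have := fixedLevel_bound hN hn hk
    omega
  have ht := fun x => hlev (isSearchData (n := n) x).le
  have huniq := fun x => herringbone_existsUnique (hu x) (ht x)
  let e : (nestedOrderedSearch (n + 1) n).domain → Q.domain := fun x =>
    ⟨herringbone (hu x) (ht x), hdom _ (herringbone_monotone (hu x) (ht x)) (huniq x)⟩
  refine QueryProblem.SA_le_mul_of_embedding _ Q 7 e (fun x y hxy => ?_) (fun x y hxy => ?_)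
    fun v => ?_
  · obtain ⟨h1, h2⟩ := herringbone_injective (hu x) (hu y) (ht x) (ht y) (congrArg Subtype.val hxy)
    have hk := Fin.ext ((fixedLevel_strictMono hn).injective h1)
    refine Subtype.ext (funext fun ⟨i, j⟩ => ?_)
    obtain ⟨a, ha, hax⟩ := hiddenPosition_spec x i
    obtain ⟨b, hb, hby⟩ := hiddenPosition_spec y i
    have hi : (i : ℕ) ≤ n := Nat.lt_succ_iff.1 i.2
    -- On the fixed level of `i` the spine has offset exactly `p i`, so the spine determines all
    -- hidden positions.
    have h3 := h2 (fixedLevel n i) (hlev hi)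
    rw [spine_fixedLevel hN hn (isSearchData x).lt hi,
      spine_fixedLevel hN hn (isSearchData y).lt hi] at h3
    rw [hax, hby, hk, Fin.ext (by omega : (a : ℕ) = b)]
  · intro heq
    have hx := (herringbone_fixed_iff (hu x) (ht x) _).1 (hans (e x) (huniq x))
    have hy := (herringbone_fixed_iff (hu y) (ht y) _).1 (hans (e y) (huniq y))
    rw [heq] at hx
    exact hxy (Fin.ext ((fixedLevel_strictMono hn).injective (hx.1.symm.trans hy.1)))
  · obtain ⟨i, i', j, d, hi, hi', hj, hd, hdet⟩ :=
      herringboneStep_determined hN hn (v 0).2 (v 1).2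
    have hresp : ∀ (i j : ℕ) (hi : i ≤ n) (hj : j < n)
        (x y : (nestedOrderedSearch (n + 1) n).domain),
        x.1 ⟨⟨i, Nat.lt_succ_of_le hi⟩, ⟨j, hj⟩⟩ = y.1 ⟨⟨i, Nat.lt_succ_of_le hi⟩, ⟨j, hj⟩⟩ →
        SameResponse i j (hiddenPosition x i) ((nestedOrderedSearch (n + 1) n).answer x)
          (hiddenPosition y i) ((nestedOrderedSearch (n + 1) n).answer y) := by
      intro i j hi hj x y hxy
      obtain ⟨a, ha, hax⟩ := hiddenPosition_spec x ⟨i, Nat.lt_succ_of_le hi⟩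
      obtain ⟨b, hb, hby⟩ := hiddenPosition_spec y ⟨i, Nat.lt_succ_of_le hi⟩
      rw [hax, hby] at hxy
      have := sameResponse_of_hsosString_eq hxy
      rwa [ha, hb] at this
    refine ⟨{⟨⟨i, Nat.lt_succ_of_le hi⟩, ⟨j, hj⟩⟩, ⟨⟨i, Nat.lt_succ_of_le hi⟩, ⟨d, hd⟩⟩,
      ⟨⟨i', Nat.lt_succ_of_le hi'⟩, ⟨d, hd⟩⟩}, Finset.card_le_three.trans (by norm_num),
      fun x y hxy => ?_⟩
    simp only [Finset.mem_insert, Finset.mem_singleton, forall_eq_or_imp, forall_eq] at hxy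
    obtain ⟨q1, q2, q3⟩ := hxy
    exact (herringbone_eq_iff (hu x) (hu y) (ht x) (ht y) v).2
      (hdet _ _ _ _ (isSearchData x) (isSearchData y) (hresp i j hi hj x y q1)
        (hresp i d hi hd x y q2) (hresp i' d hi' hd x y q3))

theorem mainTheorem5 (n : ℕ) (hn : 2 ≤ n) :
    (1 / 7 : ℝ) * (nestedOrderedSearch (n + 1) n).SA
        ≤ (tarskiUnique (n * (n ^ 2 + n - 1)) 2).SA ∧
      ∀ F : {f : Grid (n * (n ^ 2 + n - 1)) 2 → Grid (n * (n ^ 2 + n - 1)) 2 // Monotone f} →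
          Grid (n * (n ^ 2 + n - 1)) 2,
        (∀ f, f.1 (F f) = F f) →
        (1 / 7 : ℝ) * (nestedOrderedSearch (n + 1) n).SA
          ≤ (tarskiAll (n * (n ^ 2 + n - 1)) 2 F).SA := by
  -- The difference of the two sides is `(n - 1) * (n - 2)`.
  have hN : n * n * n + 2 * n - 2 ≤ n * (n ^ 2 + n - 1) := by
    obtain ⟨m, rfl⟩ : ∃ m, n = m + 2 := ⟨n - 2, by omega⟩
    have e : (m + 2) ^ 2 + (m + 2) - 1 = m ^ 2 + 5 * m + 5 := by
      have : (m + 2) ^ 2 = m ^ 2 + 4 * m + 4 := by ring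
      omega
    rw [e, Nat.sub_le_iff_le_add]
    nlinarith [sq_nonneg m]
  refine ⟨?_, fun F hF => ?_⟩
  · have := SA_nestedOrderedSearch_le hN hn (tarskiUnique _ 2) (fun f hf hu => ⟨hf, hu⟩)
      fun f _ => f.2.2.choose_spec.1
    push_cast at this
    linarith
  · have := SA_nestedOrderedSearch_le hN hn (tarskiAll _ 2 F) (fun f hf _ => hf)
      fun f _ => hF f
    push_cast at this
    linarith
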